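/- Let $G$ be a connected (finite-dimensional, smooth) Lie group with identity $e$. Let $\mathcal X$ be a linear vector field on $G$, i.e. a smooth vector field whose flow $(\varphi_t)_{t\in\mathbb R}$ is a one-parameter group of automorphisms of $G$, and let $Y_1,\dots,Y_m$ be right-invariant vector fields on $G$. Consider the linear control system $$\Sigma_L:\quad \frac{dg}{dt}=\mathcal X(g)+\sum_{j=1}^m u_j(t)\,Y_j(g),$$ where the controls $u=(u_1,\dots,u_m)\colon\mathbb R\to\mathbb R^m$ are piecewise constant, with finitely many switching times in each bounded interval. A solution for $u$ is a continuous curve in $G$ that satisfies the equation at every time that is not a switching time of $u$. Then the following hold. 1. For every control $u$ and every $g\in G$ there is exactly one solution $t\mapsto\phi_t(u,g)$, $t\in\mathbb R$, with $\phi_0(u,g)=g$. 2. For every control $u$ (in particular for every constant $u\in\mathbb R^m$), every $g\in G$ and every $t\in\mathbb R$, $$\phi_t(u,g)=\phi_t(u,e)\,\varphi_t(g).$$ 3. (Cocycle property.) For every control $u$, every $g\in G$ and all $t,s\in\mathbb R$, $\ \phi_{t+s}(u,g)=\phi_s\big(u(t+\cdot),\phi_t(u,g)\big)$. 4. Consequently,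 if $t,s\in\mathbb R$ and $u$ has the constant value $c\in\mathbb R^m$ on the open interval between $t$ and $t+s$, then for every $g\in G$ $$\phi_{t+s}(u,g)=\phi_s(c,e)\,\varphi_s\big(\phi_t(u,g)\big).$$ In particular, if $t,s\ge 0$, $u=c_1$ on $[0,t]$ and $u=c_2$ on $(t,t+s]$ with constants $c_1,c_2\in\mathbb R^m$, then $$\phi_{t+s}(u,e)=\phi_s(c_2,e)\,\varphi_s\big(\phi_t(c_1,e)\big).$$ -/

import Mathlib

open scoped Manifold ContDiff Topology

namespace LinearControl

variable {E : Type*} [NormedAddCommGroup E] [NormedSpace ℝ E]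
  {H : Type*} [TopologicalSpace H] (I : ModelWithCorners ℝ E H)
  {G : Type*} [TopologicalSpace G] [ChartedSpace H G]

/-- `φ` is the (global) flow of the vector field `X`: for every `g` the curve `t ↦ φ t g` is the
integral curve of `X` through `g` at time `0`. -/
def IsFlow (X : (g : G) → TangentSpace I g) (φ : ℝ → G → G) : Prop :=
  ∀ g : G, φ 0 g = g ∧ IsMIntegralCurve (I := I) (fun t : ℝ => φ t g) X

/-- `f` is an automorphism of the Lie group `G`: a group automorphism that is smooth together with
its inverse. -/
def IsLieAutomorphism [Group G] (f : G → G) : Prop :=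
  ∃ e : G ≃* G, (∀ g, e g = f g) ∧ ContMDiff I I ∞ e ∧ ContMDiff I I ∞ e.symm

/-- A linear vector field on `G`: a smooth vector field that has a global flow consisting of
automorphisms of `G`. (The law `φ (s + t) = φ s ∘ φ t` holds for every flow of a smooth field.) -/
def IsLinearVectorField [Group G] [IsManifold I 1 G] (X : (g : G) → TangentSpace I g) : Prop :=
  ContMDiff I I.tangent ∞ (fun g : G => (⟨g, X g⟩ : TangentBundle I G)) ∧
    ∃ φ : ℝ → G → G, IsFlow I X φ ∧ ∀ t : ℝ, IsLieAutomorphism I (φ t)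

/-- `Y` is a right-invariant vector field: `Y (g h) = d(R_h)_g (Y g)`, where `R_h x = x h`. -/
def IsRightInvariant [Group G] (Y : (g : G) → TangentSpace I g) : Prop :=
  ∀ g h : G, Y (g * h) = mfderiv I I (fun x : G => x * h) g (Y g)

/-- The right-hand side `X g + ∑ j, v j • Y j g` of the control system at the control value `v`. -/
noncomputable def systemField {m : ℕ} (X : (g : G) → TangentSpace I g)
    (Y : Fin m → (g : G) → TangentSpace I g) (v : Fin m → ℝ) (g : G) : TangentSpace I g :=
  X g + ∑ j, v j • Y j g

/-- The switching times of a control: the times around which it is not locally constant. -/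
def switchTimes {m : ℕ} (u : ℝ → Fin m → ℝ) : Set ℝ :=
  {t | ¬ ∀ᶠ r in 𝓝 t, u r = u t}

/-- A control on `ℝ` is piecewise constant if each bounded interval contains only finitely many
switching times. -/
def IsPiecewiseConstant {m : ℕ} (u : ℝ → Fin m → ℝ) : Prop :=
  ∀ a b : ℝ, (switchTimes u ∩ Set.Icc a b).Finite

/-- `γ` is a solution on `ℝ`, starting at `g`, of `γ' = X(γ) + ∑ j, u j • Y j (γ)` for a piecewise
constant control `u`: it is continuous and satisfies the equation at every time that is not a
switching time of `u`. -/
structure IsSolution {m : ℕ} (X : (g : G) → TangentSpace I g)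
    (Y : Fin m → (g : G) → TangentSpace I g) (u : ℝ → Fin m → ℝ) (g : G) (γ : ℝ → G) : Prop where
  continuous : Continuous γ
  initial : γ 0 = g
  hasMFDerivAt : ∀ t : ℝ, t ∉ switchTimes u →
    HasMFDerivAt 𝓘(ℝ, ℝ) I γ t
      ((1 : ℝ →L[ℝ] ℝ).smulRight (systemField I X Y (u t) (γ t)))

open Classical in
/-- The point `φ_t(u, g)` reached at time `t` by the solution with control `u` starting at `g`
(a junk value if there is no solution). -/
noncomputable def solution {m : ℕ} (X : (g : G) → TangentSpace I g)
    (Y : Fin m → (g : G) → TangentSpace I g) (t : ℝ) (u : ℝ → Fin m → ℝ) (g : G) : G :=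
  if h : ∃ γ : ℝ → G, IsSolution I X Y u g γ then h.choose t else g

end LinearControl

/-! Differentiating `φ t (a * b) = φ t a * φ t b` at `t = 0` shows that `X` is an infinitesimal
automorphism: `X (a * b)` is the right translate of `X a` plus the left translate of `X b`. Each `Y
j` contributes only a right translate. By the product rule, a solution for `u` multiplied on the
right by a flow line `φ t g` is again a solution for `u` (`solvesOn_mul_flow`).

This is used twice. Together with uniqueness it gives the factorization. It also gives completeness
for constant controls (`isCompleteFamily_systemField`): a local integral curve through `1` on `(-ε,
ε)` yields one through every `g` with the same `ε`.

The rest holds for any complete family of `C^1` fields. Uniqueness for piecewise constant controls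
propagates equality across each time from one side to the other (`eqOn_Icc_of_solvesOn`); existence
glues constant-control pieces along a finite partition (`exists_solvesOn_univ`). The cocycle
property is uniqueness applied to a time-shifted solution. -/

namespace LinearControl

open Set Filter

/-! ### Isolated points and one-sided uniqueness for integral curves -/

section Manifold

variable {E : Type*} [NormedAddCommGroup E] [NormedSpace ℝ E]
  {H : Type*} [TopologicalSpace H] {I : ModelWithCorners ℝ E H}
  {M : Type*} [TopologicalSpace M] [ChartedSpace H M] [IsManifold I 1 M]

/-- A function that is continuous at `a`, with derivative `g` at the nearby points and `g` continuous
at `a`, has derivative `g a` at `a`. -/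
theorem hasDerivAt_of_eventually_ne {f g : ℝ → E} {a : ℝ}
    (h : ∀ᶠ t in 𝓝[≠] a, HasDerivAt f (g t) t) (hf : ContinuousAt f a) (hg : ContinuousAt g a) :
    HasDerivAt f (g a) a := by
  have key (s : Set ℝ) (hs : s ⊆ {a}ᶜ) : {t | HasDerivAt f (g t) t} ∈ 𝓝[s] a ∧
      Tendsto (deriv f) (𝓝[s] a) (𝓝 (g a)) := by
    have h' := h.filter_mono (nhdsWithin_mono a hs)
    exact ⟨h', (hg.mono_left nhdsWithin_le_nhds).congr' (h'.mono fun t ht => ht.deriv.symm)⟩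
  have hd : DifferentiableOn ℝ f {t | HasDerivAt f (g t) t} := fun t ht =>
    (show HasDerivAt f (g t) t from ht).differentiableAt.differentiableWithinAt
  obtain ⟨hr, hr'⟩ := key (Ioi a) fun t ht => (ne_of_gt ht : t ≠ a)
  obtain ⟨hl, hl'⟩ := key (Iio a) fun t ht => (ne_of_lt ht : t ≠ a)
  have A := hasDerivWithinAt_Ici_of_tendsto_deriv hd hf.continuousWithinAt hr hr'
  have B := hasDerivWithinAt_Iic_of_tendsto_deriv hd hf.continuousWithinAt hl hl'
  simpa using B.union A

/-- The integral curve equation of a `C^1` vector field extends to an isolated point of a continuous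
curve. -/
theorem hasMFDerivAt_of_eventually_ne {V : (x : M) → TangentSpace I x}
    (hV : ContMDiff I I.tangent 1 (fun x : M => (⟨x, V x⟩ : TangentBundle I M)))
    {γ : ℝ → M} {t₀ : ℝ} (hγ : ContinuousAt γ t₀)
    (h : ∀ᶠ t in 𝓝[≠] t₀, HasMFDerivAt 𝓘(ℝ, ℝ) I γ t
      ((1 : ℝ →L[ℝ] ℝ).smulRight (V (γ t)))) :
    HasMFDerivAt 𝓘(ℝ, ℝ) I γ t₀ ((1 : ℝ →L[ℝ] ℝ).smulRight (V (γ t₀))) := by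
  set f : ℝ → E := extChartAt I (γ t₀) ∘ γ with hf
  set g : ℝ → E := fun t => tangentCoordChange I (γ t) (γ t₀) (γ t) (V (γ t)) with hg
  have hsrc : ∀ᶠ t in 𝓝 t₀, γ t ∈ (extChartAt I (γ t₀)).source :=
    hγ.preimage_mem_nhds (extChartAt_source_mem_nhds (I := I) _)
  have hder : ∀ᶠ t in 𝓝[≠] t₀, HasDerivAt f (g t) t := by
    filter_upwards [eventually_eventually_nhdsWithin.2 h, self_mem_nhdsWithin,
      hsrc.filter_mono nhdsWithin_le_nhds] with t ht htne hts
    rw [isOpen_compl_singleton.nhdsWithin_eq htne] at ht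
    obtain ⟨s, hs, hs'⟩ := isMIntegralCurveAt_iff.1 (show IsMIntegralCurveAt γ V t from ht)
    exact (hs'.hasDerivWithinAt (mem_of_mem_nhds hs) hts).hasDerivAt hs
  have hfc : ContinuousAt f t₀ := (continuousAt_extChartAt (γ t₀)).comp hγ
  -- `g` is the local expression of `V` in the trivialization at `γ t₀`, evaluated along `γ`.
  have hgc : ContinuousAt g t₀ := by
    have h1 : ContinuousAt (fun x : M => (trivializationAt E (TangentSpace I) (γ t₀)
        (⟨x, V x⟩ : TangentBundle I M)).2) (γ t₀) :=
      ((Bundle.contMDiffAt_section (γ t₀)).1 (hV (γ t₀))).continuousAt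
    exact h1.comp hγ
  have hmain : HasDerivAt f (g t₀) t₀ := hasDerivAt_of_eventually_ne hder hfc hgc
  have hself : g t₀ = V (γ t₀) := tangentCoordChange_self (mem_extChartAt_source _)
  refine ⟨hγ, ?_⟩
  rw [hself] at hmain
  have hw : writtenInExtChartAt 𝓘(ℝ, ℝ) I t₀ γ = f := by
    ext t
    simp only [writtenInExtChartAt, hf, mfld_simps]
    rfl
  rw [hw]
  exact hmain.hasFDerivAt.hasFDerivWithinAt

/-- Two continuous curves that agree at `t₀` and solve on one side of `t₀` the equation of a `C^1`
vector field agree on that side near `t₀`. -/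
theorem eventuallyEq_nhdsWithin_of_isMIntegralCurve [BoundarylessManifold I M]
    {V : (x : M) → TangentSpace I x}
    (hV : ContMDiff I I.tangent 1 (fun x : M => (⟨x, V x⟩ : TangentBundle I M)))
    {γ ψ : ℝ → M} {t₀ : ℝ} {s : Set ℝ} (hs : IsOpen s) (hfr : frontier s ⊆ {t₀})
    (ht₀ : t₀ ∉ s)
    (hγ : Continuous γ) (hψ : IsMIntegralCurve (I := I) ψ V) (h₀ : γ t₀ = ψ t₀)
    (h : ∀ᶠ t in 𝓝[s] t₀, HasMFDerivAt 𝓘(ℝ, ℝ) I γ t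
      ((1 : ℝ →L[ℝ] ℝ).smulRight (V (γ t)))) :
    γ =ᶠ[𝓝[s] t₀] ψ := by
  classical
  -- The pasted curve solves the equation near `t₀` except perhaps at `t₀`, hence also there, so
  -- two-sided local uniqueness applies to `χ` and `ψ`.
  set χ : ℝ → M := s.piecewise γ ψ with hχ
  have hc : Continuous χ := Continuous.piecewise
    (fun a ha => by rw [mem_singleton_iff.1 (hfr ha), h₀]) hγ hψ.continuous
  have hχ₀ : χ t₀ = ψ t₀ := by simp [hχ, ht₀]
  have hne : ∀ᶠ t in 𝓝[≠] t₀, HasMFDerivAt 𝓘(ℝ, ℝ) I χ t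
      ((1 : ℝ →L[ℝ] ℝ).smulRight (V (χ t))) := by
    rw [eventually_nhdsWithin_iff] at h ⊢
    filter_upwards [h] with t ht hne
    by_cases hts : t ∈ s
    · have heq : χ =ᶠ[𝓝 t] γ := by
        filter_upwards [hs.mem_nhds hts] with r hr
        simp [hχ, hr]
      have := (ht hts).congr_of_eventuallyEq heq
      rwa [← heq.eq_of_nhds] at this
    · have hcl : t ∉ closure s := fun hcl => hne (hfr ⟨hcl, by rwa [hs.interior_eq]⟩)
      have heq : χ =ᶠ[𝓝 t] ψ := by
        filter_upwards [isClosed_closure.isOpen_compl.mem_nhds hcl] with r hr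
        have : r ∉ s := fun h => hr (subset_closure h)
        simp [hχ, this]
      have := (hψ t).congr_of_eventuallyEq heq
      rwa [← heq.eq_of_nhds] at this
  have hat : IsMIntegralCurveAt (I := I) χ V t₀ := by
    have h1 := hasMFDerivAt_of_eventually_ne hV hc.continuousAt hne
    have h2 := eventually_nhdsWithin_iff.1 hne
    filter_upwards [h2] with t ht
    by_cases htt : t = t₀
    · rw [htt]; exact h1
    · exact ht htt
  have heq := isMIntegralCurveAt_eventuallyEq_of_contMDiffAt_boundaryless hV.contMDiffAt hat
    (hψ.isMIntegralCurveAt t₀) hχ₀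
  filter_upwards [heq.filter_mono nhdsWithin_le_nhds, self_mem_nhdsWithin] with t ht hts
  rw [← ht]
  simp [hχ, hts]

end Manifold

/-! ### Piecewise constant controls -/

section Control

variable {m : ℕ}

theorem exists_eq_of_disjoint_switchTimes {u : ℝ → Fin m → ℝ} {a b : ℝ}
    (h : ∀ t ∈ Ioo a b, t ∉ switchTimes u) : ∃ c, ∀ t ∈ Ioo a b, u t = c := by
  rcases (Ioo a b).eq_empty_or_nonempty with he | ⟨t₀, ht₀⟩
  · exact ⟨0, by simp [he]⟩
  · refine ⟨u t₀, fun t ht => ?_⟩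
    have hc : IsLocallyConstant fun r : Ioo a b => u r := by
      rw [IsLocallyConstant.iff_eventually_eq]
      intro r
      exact continuous_subtype_val.continuousAt.eventually (not_not.1 (h r r.2))
    have : PreconnectedSpace (Ioo a b) := isPreconnected_iff_preconnectedSpace.1 isPreconnected_Ioo
    exact hc.apply_eq_of_preconnectedSpace ⟨t, ht⟩ ⟨t₀, ht₀⟩

/-- A piecewise constant control has a value on each side of every time. -/
theorem IsPiecewiseConstant.exists_sides {u : ℝ → Fin m → ℝ} (hu : IsPiecewiseConstant u)
    (t₀ : ℝ) : ∃ δ > 0, ∃ c d : Fin m → ℝ,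
      (∀ t ∈ Ioo (t₀ - δ) t₀, t ∉ switchTimes u ∧ u t = c) ∧
      (∀ t ∈ Ioo t₀ (t₀ + δ), t ∉ switchTimes u ∧ u t = d) := by
  -- The finitely many switching times near `t₀`, other than `t₀` itself, form a closed set missing
  -- `t₀`.
  have hcl := ((hu (t₀ - 1) (t₀ + 1)).sdiff (t := {t₀})).isClosed
  obtain ⟨ε, hε, hball⟩ := Metric.isOpen_iff.1 hcl.isOpen_compl t₀ (by simp)
  have hno : ∀ t, |t - t₀| < min ε 1 → t ≠ t₀ → t ∉ switchTimes u := by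
    intro t ht hne hsw
    have h1 := abs_lt.1 (ht.trans_le (min_le_right _ _))
    have h2 : t ∈ Metric.ball t₀ ε := by
      rw [Metric.mem_ball, Real.dist_eq]
      exact ht.trans_le (min_le_left _ _)
    exact hball h2 ⟨⟨hsw, by linarith, by linarith⟩, hne⟩
  have hpos : 0 < min ε 1 := by positivity
  have hl : ∀ t ∈ Ioo (t₀ - min ε 1) t₀, t ∉ switchTimes u := fun t ht =>
    hno t (abs_lt.2 ⟨by linarith [ht.1], by linarith [ht.2]⟩) ht.2.ne
  have hr : ∀ t ∈ Ioo t₀ (t₀ + min ε 1), t ∉ switchTimes u := fun t ht =>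
    hno t (abs_lt.2 ⟨by linarith [ht.1], by linarith [ht.2]⟩) ht.1.ne'
  obtain ⟨c, hc⟩ := exists_eq_of_disjoint_switchTimes hl
  obtain ⟨d, hd⟩ := exists_eq_of_disjoint_switchTimes hr
  exact ⟨_, hpos, c, d, fun t ht => ⟨hl t ht, hc t ht⟩, fun t ht => ⟨hr t ht, hd t ht⟩⟩

theorem switchTimes_const (c : Fin m → ℝ) : switchTimes (fun _ : ℝ => c) = ∅ := by
  simp [switchTimes]

theorem isPiecewiseConstant_const (c : Fin m → ℝ) : IsPiecewiseConstant (fun _ : ℝ => c) := by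
  simp [IsPiecewiseConstant, switchTimes_const]

theorem mem_switchTimes_comp_add {u : ℝ → Fin m → ℝ} {t r : ℝ} :
    r ∈ switchTimes (fun s => u (t + s)) ↔ t + r ∈ switchTimes u := by
  simp only [switchTimes, mem_ofPred_eq]
  rw [← map_add_left_nhds, eventually_map]

theorem IsPiecewiseConstant.comp_add {u : ℝ → Fin m → ℝ} (hu : IsPiecewiseConstant u) (t : ℝ) :
    IsPiecewiseConstant (fun s => u (t + s)) := by
  intro a b
  refine ((hu (t + a) (t + b)).preimage (f := fun r => t + r)
    (add_right_injective t).injOn).subset ?_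
  rintro r ⟨hr, h1, h2⟩
  exact ⟨mem_switchTimes_comp_add.1 hr, by linarith, by linarith⟩

end Control

/-! ### Existence and uniqueness for switched equations -/

section Switched

variable {E : Type*} [NormedAddCommGroup E] [NormedSpace ℝ E]
  {H : Type*} [TopologicalSpace H] {I : ModelWithCorners ℝ E H}
  {M : Type*} [TopologicalSpace M] [ChartedSpace H M] {m : ℕ}

variable (I) in
/-- `γ` satisfies `γ' = F (u t) (γ)` at the times in `s` that are not switching times of `u`. -/
def SolvesOn (F : (Fin m → ℝ) → (x : M) → TangentSpace I x) (u : ℝ → Fin m → ℝ) (s : Set ℝ)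
    (γ : ℝ → M) : Prop :=
  ∀ t ∈ s, t ∉ switchTimes u →
    HasMFDerivAt 𝓘(ℝ, ℝ) I γ t ((1 : ℝ →L[ℝ] ℝ).smulRight (F (u t) (γ t)))

variable (I) in
/-- Each field of the family is `C^1` and has a global integral curve through every point at every
time. -/
structure IsCompleteFamily [IsManifold I 1 M]
    (F : (Fin m → ℝ) → (x : M) → TangentSpace I x) : Prop where
  contMDiff : ∀ c, ContMDiff I I.tangent 1 (fun x : M => (⟨x, F c x⟩ : TangentBundle I M))
  exists_curve : ∀ c (x : M) (t₀ : ℝ), ∃ ψ : ℝ → M, ψ t₀ = x ∧ IsMIntegralCurve (I := I) ψ (F c)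

variable {F : (Fin m → ℝ) → (x : M) → TangentSpace I x} {u : ℝ → Fin m → ℝ} {s : Set ℝ}
  {γ γ₁ γ₂ : ℝ → M}

theorem SolvesOn.mono (h : SolvesOn I F u s γ) {s' : Set ℝ} (hs : s' ⊆ s) : SolvesOn I F u s' γ :=
  fun t ht => h t (hs ht)

theorem SolvesOn.congr (h : SolvesOn I F u s γ₁) (hs : IsOpen s) (heq : EqOn γ₂ γ₁ s) :
    SolvesOn I F u s γ₂ := by
  intro t ht hsw
  have heq' : γ₂ =ᶠ[𝓝 t] γ₁ := heq.eventuallyEq_of_mem (hs.mem_nhds ht)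
  have := (h t ht hsw).congr_of_eventuallyEq heq'
  rwa [← heq'.eq_of_nhds] at this

theorem notMem_switchTimes_of_isOpen {c : Fin m → ℝ} (hs : IsOpen s) (h : ∀ t ∈ s, u t = c) {t : ℝ}
    (ht : t ∈ s) : t ∉ switchTimes u := by
  refine not_not.2 ?_
  filter_upwards [hs.mem_nhds ht] with r hr
  rw [h r hr, h t ht]

variable [IsManifold I 1 M] [BoundarylessManifold I M] [T2Space M]

omit [T2Space M] in
/-- Two continuous solutions that agree at `t₀` agree near `t₀` on a side on which the control is
constant. -/
theorem eventuallyEq_side (hF : IsCompleteFamily I F) (h₁ : Continuous γ₁) (h₂ : Continuous γ₂)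
    {t₀ : ℝ} (h₀ : γ₁ t₀ = γ₂ t₀) (hs : IsOpen s) (hfr : frontier s ⊆ {t₀}) (ht₀ : t₀ ∉ s)
    {c : Fin m → ℝ} (hc : ∀ᶠ t in 𝓝[s] t₀, t ∉ switchTimes u ∧ u t = c) {s' : Set ℝ}
    (hs' : s' ∈ 𝓝[s] t₀) (e₁ : SolvesOn I F u s' γ₁) (e₂ : SolvesOn I F u s' γ₂) :
    γ₁ =ᶠ[𝓝[s] t₀] γ₂ := by
  -- Both solutions are compared with the integral curve of the field for the constant value `c` on
  -- this side.
  obtain ⟨ψ, hψ₀, hψ⟩ := hF.exists_curve c (γ₁ t₀) t₀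
  have key {γ : ℝ → M} (hγ : Continuous γ) (h : γ t₀ = γ₁ t₀) (e : SolvesOn I F u s' γ) :
      γ =ᶠ[𝓝[s] t₀] ψ := by
    refine eventuallyEq_nhdsWithin_of_isMIntegralCurve (hF.contMDiff c) hs hfr ht₀ hγ hψ
      (h.trans hψ₀.symm) ?_
    filter_upwards [hc, hs'] with t ht hts
    have := e t hts ht.1
    rwa [ht.2] at this
  exact (key h₁ rfl e₁).trans (key h₂ h₀.symm e₂).symm

omit [T2Space M] in
theorem eventuallyEq_right (hF : IsCompleteFamily I F) (hu : IsPiecewiseConstant u)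
    (h₁ : Continuous γ₁) (h₂ : Continuous γ₂) {t₀ b : ℝ} (hb : t₀ < b) (h₀ : γ₁ t₀ = γ₂ t₀)
    (e₁ : SolvesOn I F u (Ioo t₀ b) γ₁) (e₂ : SolvesOn I F u (Ioo t₀ b) γ₂) :
    γ₁ =ᶠ[𝓝[>] t₀] γ₂ := by
  obtain ⟨δ, hδ, -, d, -, hd⟩ := hu.exists_sides t₀
  refine eventuallyEq_side hF h₁ h₂ h₀ isOpen_Ioi (by simp) (by simp) (c := d) ?_
    (Ioo_mem_nhdsGT hb) e₁ e₂
  filter_upwards [Ioo_mem_nhdsGT (show t₀ < t₀ + δ by linarith)] with t ht using hd t ht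

omit [T2Space M] in
theorem eventuallyEq_left (hF : IsCompleteFamily I F) (hu : IsPiecewiseConstant u)
    (h₁ : Continuous γ₁) (h₂ : Continuous γ₂) {t₀ a : ℝ} (ha : a < t₀) (h₀ : γ₁ t₀ = γ₂ t₀)
    (e₁ : SolvesOn I F u (Ioo a t₀) γ₁) (e₂ : SolvesOn I F u (Ioo a t₀) γ₂) :
    γ₁ =ᶠ[𝓝[<] t₀] γ₂ := by
  obtain ⟨δ, hδ, c, -, hc, -⟩ := hu.exists_sides t₀
  refine eventuallyEq_side hF h₁ h₂ h₀ isOpen_Iio (by simp) (by simp) (c := c) ?_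
    (Ioo_mem_nhdsLT ha) e₁ e₂
  filter_upwards [Ioo_mem_nhdsLT (show t₀ - δ < t₀ by linarith)] with t ht using hc t ht

/-- Solutions of the switched equation on an interval are unique. -/
theorem eqOn_Icc_of_solvesOn (hF : IsCompleteFamily I F) (hu : IsPiecewiseConstant u)
    (h₁ : Continuous γ₁) (h₂ : Continuous γ₂) {a b t₀ : ℝ} (ht₀ : t₀ ∈ Icc a b)
    (h₀ : γ₁ t₀ = γ₂ t₀)
    (e₁ : SolvesOn I F u (Ioo a b) γ₁) (e₂ : SolvesOn I F u (Ioo a b) γ₂) :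
    EqOn γ₁ γ₂ (Icc a b) := by
  have hcl : IsClosed {t | γ₁ t = γ₂ t} := isClosed_eq h₁ h₂
  rintro t ⟨hat, htb⟩
  rcases le_total t₀ t with h | h
  -- Continuous induction: the agreement set is closed, and agreement at a point spreads to its
  -- right (below, to its left).
  · refine (hcl.inter isClosed_Icc).Icc_subset_of_forall_mem_nhdsWithin (a := t₀) (b := t) h₀ ?_
      ⟨h, le_rfl⟩
    rintro x ⟨hx, hx'⟩
    refine eventuallyEq_right hF hu h₁ h₂ (b := b) (by linarith [hx'.2]) hx (e₁.mono ?_)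
      (e₂.mono ?_) <;> exact Ioo_subset_Ioo_left (by linarith [hx'.1, ht₀.1])
  · refine (hcl.inter isClosed_Icc).Icc_subset_of_forall_exists_lt (a := t) (b := t₀) h₀ ?_
      ⟨le_rfl, h⟩
    rintro x ⟨hx, hx'⟩ y hy
    have hev : γ₁ =ᶠ[𝓝[<] x] γ₂ := by
      refine eventuallyEq_left hF hu h₁ h₂ (a := a) (by linarith [hx'.1]) hx (e₁.mono ?_)
        (e₂.mono ?_) <;> exact Ioo_subset_Ioo_right (by linarith [hx'.2, ht₀.2])
    exact (hev.and (Ico_mem_nhdsLT hy)).exists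

omit [T2Space M] [BoundarylessManifold I M] in
/-- Two solutions on adjacent intervals that agree at the common endpoint have a common
extension. -/
theorem exists_solvesOn_glue (hF : IsCompleteFamily I F) (h₁ : Continuous γ₁) (h₂ : Continuous γ₂)
    {a b c : ℝ} (hab : a < b) (hbc : b < c) (h₀ : γ₁ b = γ₂ b)
    (e₁ : SolvesOn I F u (Ioo a b) γ₁) (e₂ : SolvesOn I F u (Ioo b c) γ₂) :
    ∃ γ : ℝ → M, Continuous γ ∧ EqOn γ γ₁ (Iic b) ∧ EqOn γ γ₂ (Ici b) ∧
      SolvesOn I F u (Ioo a c) γ := by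
  have heq₁ : EqOn (fun t => if t ≤ b then γ₁ t else γ₂ t) γ₁ (Iic b) := fun t ht => if_pos ht
  have heq₂ : EqOn (fun t => if t ≤ b then γ₁ t else γ₂ t) γ₂ (Ici b) := by
    rintro t (ht : b ≤ t)
    rcases ht.eq_or_lt with rfl | ht
    · simpa using h₀
    · exact if_neg ht.not_ge
  have hcont : Continuous fun t => if t ≤ b then γ₁ t else γ₂ t :=
    Continuous.if_le h₁ h₂ continuous_id continuous_const (by rintro t rfl; exact h₀)
  refine ⟨_, hcont, heq₁, heq₂, ?_⟩
  have f₁ := e₁.congr isOpen_Ioo (heq₁.mono fun t ht => ht.2.le)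
  have f₂ := e₂.congr isOpen_Ioo (heq₂.mono fun t ht => ht.1.le)
  intro t ht hsw
  rcases lt_trichotomy t b with h | rfl | h
  · exact f₁ t ⟨ht.1, h⟩ hsw
  -- Here the junction is not a switching time, so one field governs both sides and the equation
  -- extends to the junction.
  · refine hasMFDerivAt_of_eventually_ne (hF.contMDiff (u t)) hcont.continuousAt ?_
    have hev : ∀ᶠ r in 𝓝 t, u r = u t := not_not.1 hsw
    rw [eventually_nhdsWithin_iff]
    filter_upwards [hev, eventually_eventually_nhds.2 hev, Ioo_mem_nhds hab hbc]
      with r hr hr' hrI hne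
    have hrsw : r ∉ switchTimes u := not_not.2 (by rw [hr]; exact hr')
    rw [← hr]
    rcases lt_or_gt_of_ne hne with h | h
    · exact f₁ r ⟨hrI.1, h⟩ hrsw
    · exact f₂ r ⟨h, hrI.2⟩ hrsw
  · exact f₂ t ⟨h, ht.2⟩ hsw

variable (I) in
/-- The initial value problem for the switched equation is solvable on `[a, b]` for all initial
times in `[a, b]` and all initial points. -/
def IsSolvableOn (F : (Fin m → ℝ) → (x : M) → TangentSpace I x) (u : ℝ → Fin m → ℝ)
    (a b : ℝ) : Prop :=
  ∀ t₀ ∈ Icc a b, ∀ x : M, ∃ γ : ℝ → M, Continuous γ ∧ γ t₀ = x ∧ SolvesOn I F u (Ioo a b) γ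

omit [IsManifold I 1 M] [T2Space M] [BoundarylessManifold I M] in
theorem IsSolvableOn.mono {a b a' b' : ℝ} (h : IsSolvableOn I F u a b) (ha : a ≤ a')
    (hb : b' ≤ b) : IsSolvableOn I F u a' b' := by
  intro t₀ ht₀ x
  obtain ⟨γ, hγ, h₀, e⟩ := h t₀ (Icc_subset_Icc ha hb ht₀) x
  exact ⟨γ, hγ, h₀, e.mono (Ioo_subset_Ioo ha hb)⟩

omit [T2Space M] [BoundarylessManifold I M] in
theorem isSolvableOn_of_const (hF : IsCompleteFamily I F) {a b : ℝ} {c : Fin m → ℝ}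
    (h : ∀ t ∈ Ioo a b, u t = c) : IsSolvableOn I F u a b := by
  intro t₀ _ x
  obtain ⟨ψ, hψ₀, hψ⟩ := hF.exists_curve c x t₀
  refine ⟨ψ, hψ.continuous, hψ₀, fun t ht _ => ?_⟩
  rw [h t ht]
  exact hψ t

omit [T2Space M] [BoundarylessManifold I M] in
theorem IsSolvableOn.trans (hF : IsCompleteFamily I F) {a b c : ℝ} (hab : a ≤ b) (hbc : b ≤ c)
    (h₁ : IsSolvableOn I F u a b) (h₂ : IsSolvableOn I F u b c) : IsSolvableOn I F u a c := by
  rcases hab.eq_or_lt with rfl | hab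
  · exact h₂
  rcases hbc.eq_or_lt with rfl | hbc
  · exact h₁
  intro t₀ ht₀ x
  rcases le_total t₀ b with h | h
  · obtain ⟨γ₁, hγ₁, hx, e₁⟩ := h₁ t₀ ⟨ht₀.1, h⟩ x
    obtain ⟨γ₂, hγ₂, h₀, e₂⟩ := h₂ b ⟨le_rfl, hbc.le⟩ (γ₁ b)
    obtain ⟨γ, hγ, q₁, -, e⟩ := exists_solvesOn_glue hF hγ₁ hγ₂ hab hbc h₀.symm e₁ e₂
    exact ⟨γ, hγ, (q₁ h).trans hx, e⟩
  · obtain ⟨γ₂, hγ₂, hx, e₂⟩ := h₂ t₀ ⟨h, ht₀.2⟩ x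
    obtain ⟨γ₁, hγ₁, h₀, e₁⟩ := h₁ b ⟨hab.le, le_rfl⟩ (γ₂ b)
    obtain ⟨γ, hγ, -, q₂, e⟩ := exists_solvesOn_glue hF hγ₁ hγ₂ hab hbc h₀ e₁ e₂
    exact ⟨γ, hγ, (q₂ h).trans hx, e⟩

omit [T2Space M] [BoundarylessManifold I M] in
theorem isSolvableOn_of_isPiecewiseConstant (hF : IsCompleteFamily I F)
    (hu : IsPiecewiseConstant u) {a b : ℝ} (hab : a ≤ b) : IsSolvableOn I F u a b := by
  choose δ hδ c d hc hd using hu.exists_sides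
  -- The control is constant on either side of `t`; compactness of `[a, b]` then leaves finitely
  -- many such intervals to glue.
  have hloc (t : ℝ) : IsSolvableOn I F u (t - δ t) (t + δ t) :=
    .trans hF (by linarith [hδ t]) (by linarith [hδ t])
      (isSolvableOn_of_const hF fun r hr => (hc t r hr).2)
      (isSolvableOn_of_const hF fun r hr => (hd t r hr).2)
  obtain ⟨p, hp₀, hp, ⟨n, hn⟩, hcov⟩ := exists_monotone_Icc_subset_open_cover_Icc hab
    (c := fun t : ℝ => {r : Icc a b | (r : ℝ) ∈ Ioo (t - δ t) (t + δ t)})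
    (fun t => isOpen_Ioo.preimage continuous_subtype_val) fun t _ =>
      mem_iUnion.2 ⟨t, by linarith [hδ t], by linarith [hδ t]⟩
  have hind (k : ℕ) : IsSolvableOn I F u a (p k) := by
    induction k with
    | zero => exact isSolvableOn_of_const hF (c := 0) (by simp [hp₀])
    | succ k ih =>
      have hle : p k ≤ p (k + 1) := hp k.le_succ
      obtain ⟨t, ht⟩ := hcov k
      exact ih.trans hF (p k).2.1 hle
        ((hloc t).mono (ht ⟨le_rfl, hle⟩).1.le (ht ⟨hle, le_rfl⟩).2.le)
  rw [← hn n le_rfl]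
  exact hind n

/-- The switched equation has a global solution through every point. -/
theorem exists_solvesOn_univ (hF : IsCompleteFamily I F) (hu : IsPiecewiseConstant u) (x : M) :
    ∃ γ : ℝ → M, Continuous γ ∧ γ 0 = x ∧ SolvesOn I F u univ γ := by
  have hex (a : ℝ) : ∃ γ : ℝ → M, Continuous γ ∧ γ 0 = x ∧ SolvesOn I F u (Ioo (-a) a) γ := by
    rcases le_total 0 a with ha | ha
    · exact isSolvableOn_of_isPiecewiseConstant hF hu (by linarith) 0 ⟨by linarith, ha⟩ x
    · exact ⟨fun _ => x, continuous_const, rfl, by simp [SolvesOn, Ioo_eq_empty, ha]⟩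
  choose γ hγ h₀ e using hex
  have heq {a t : ℝ} (ht : |t| < a) : γ (|t| + 1) t = γ a t := by
    have hle : ∀ {a b s : ℝ}, a ≤ b → |s| ≤ a → γ a s = γ b s := fun {a b s} hab hs =>
      have h0a : 0 ≤ a := (abs_nonneg s).trans hs
      eqOn_Icc_of_solvesOn hF hu (hγ a) (hγ b) (t₀ := 0) ⟨by linarith, h0a⟩
        ((h₀ a).trans (h₀ b).symm) (e a) ((e b).mono (Ioo_subset_Ioo (by linarith) hab))
        (abs_le.1 hs)
    rcases le_total (|t| + 1) a with h | h
    · exact hle h (by linarith)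
    · exact (hle h ht.le).symm
  have hon (a : ℝ) : EqOn (fun t => γ (|t| + 1) t) (γ a) (Ioo (-a) a) := fun t ht =>
    heq (abs_lt.2 ht)
  have hmem (t : ℝ) : t ∈ Ioo (-(|t| + 1)) (|t| + 1) := abs_lt.1 (lt_add_one _)
  -- At time `t` use the solution on an interval containing `t` in its interior; by uniqueness this
  -- coincides near `t` with a single solution.
  refine ⟨fun t => γ (|t| + 1) t, ?_, h₀ _, ?_⟩
  · refine continuous_iff_continuousAt.2 fun t => ?_
    exact (hγ (|t| + 1)).continuousAt.congr
      ((hon _).eventuallyEq_of_mem (isOpen_Ioo.mem_nhds (hmem t))).symm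
  · intro t _
    exact ((e (|t| + 1)).congr isOpen_Ioo (hon _)) t (hmem t)

end Switched

/-! ### Product rule, infinitesimal automorphisms and right-invariant fields -/

section LieGroup

variable {E : Type*} [NormedAddCommGroup E] [NormedSpace ℝ E]
  {H : Type*} [TopologicalSpace H] {I : ModelWithCorners ℝ E H}
  {G : Type*} [TopologicalSpace G] [ChartedSpace H G] [Group G] [LieGroup I ∞ G]

/-- The product rule for curves in a Lie group. -/
theorem hasMFDerivAt_mul_curve {γ δ : ℝ → G} {t : ℝ} {v : TangentSpace I (γ t)}
    {w : TangentSpace I (δ t)}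
    (hγ : HasMFDerivAt 𝓘(ℝ, ℝ) I γ t ((1 : ℝ →L[ℝ] ℝ).smulRight v))
    (hδ : HasMFDerivAt 𝓘(ℝ, ℝ) I δ t ((1 : ℝ →L[ℝ] ℝ).smulRight w)) :
    HasMFDerivAt 𝓘(ℝ, ℝ) I (fun r => γ r * δ r) t ((1 : ℝ →L[ℝ] ℝ).smulRight
      ((mfderiv I I (fun x : G => x * δ t) (γ t) v +
        mfderiv I I (fun x : G => γ t * x) (δ t) w : E) : TangentSpace I (γ t * δ t))) := by
  have hmul : MDifferentiableAt (I.prod I) I (fun p : G × G => p.1 * p.2) (γ t, δ t) :=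
    (contMDiff_mul I ∞).mdifferentiableAt (by simp)
  refine (hmul.hasMFDerivAt.comp t (hγ.prodMk hδ)).congr_mfderiv ?_
  ext
  have l1 : ∀ e : E, ((1 : ℝ →L[ℝ] ℝ).smulRight e) (1 : ℝ) = e := fun e => by simp
  have h1 := mfderiv_prod_eq_add_apply (v := ((id v : E), (id w : E))) hmul
  refine Eq.trans ?_ (h1.trans (l1 _).symm)
  exact congrArg (mfderiv (I.prod I) I (fun p : G × G => p.1 * p.2) (γ t, δ t))
    (Prod.ext (l1 (id v : E)) (l1 (id w : E)))

/-- A field with a flow by automorphisms is an infinitesimal automorphism. -/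
theorem IsFlow.apply_mul {X : (g : G) → TangentSpace I g} {φ : ℝ → G → G} (hφ : IsFlow I X φ)
    (hmul : ∀ t a b, φ t (a * b) = φ t a * φ t b) (a b : G) :
    X (a * b) = (mfderiv I I (fun x : G => x * b) a (X a) +
      mfderiv I I (fun x : G => a * x) b (X b) : E) := by
  have h := hasMFDerivAt_mul_curve ((hφ a).2 0) ((hφ b).2 0)
  have h' := ((hφ (a * b)).2 0).congr_of_eventuallyEq (f₁ := fun r => φ r a * φ r b)
    (Eventually.of_forall fun t => (hmul t a b).symm)
  -- The tangent spaces depend on the base points, so `φ 0 a = a` is used by substituting for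
  -- variables instead of rewriting.
  have h0 : ∀ a' b' c' : G, a' = a → b' = b → c' = a * b →
      (X c' : E) = (mfderiv I I (fun x : G => x * b') a' (X a') +
        mfderiv I I (fun x : G => a' * x) b' (X b') : E) →
      X (a * b) = (mfderiv I I (fun x : G => x * b) a (X a) +
        mfderiv I I (fun x : G => a * x) b (X b) : E) := by
    rintro a' b' c' rfl rfl rfl h
    exact h
  refine h0 _ _ _ (hφ a).1 (hφ b).1 (hφ (a * b)).1 ?_
  have key := DFunLike.congr_fun (hasMFDerivAt_unique h' h) (1 : ℝ)
  have l1 : ∀ e : E, ((1 : ℝ →L[ℝ] ℝ).smulRight e) (1 : ℝ) = e := fun e => by simp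
  exact (l1 _).symm.trans (key.trans (l1 _))

/-- `Y g` is the differential of multiplication at `(1, g)` applied to `(Y 1, 0)`, which depends on
`g` in a `C^1` way. -/
theorem contMDiff_of_isRightInvariant {Y : (g : G) → TangentSpace I g} (hY : IsRightInvariant I Y) :
    ContMDiff I I.tangent 1 (fun g : G => (⟨g, Y g⟩ : TangentBundle I G)) := by
  let fg : G → TangentBundle I G := fun g ↦ Bundle.TotalSpace.mk' E g 0
  have sfg : ContMDiff I I.tangent 1 fg := Bundle.contMDiff_zeroSection _ _
  let fv : G → TangentBundle I G := fun _ ↦ Bundle.TotalSpace.mk' E 1 (Y 1)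
  have sfv : ContMDiff I I.tangent 1 fv := contMDiff_const
  let F₁ : G → (TangentBundle I G × TangentBundle I G) := fun g ↦ (fv g, fg g)
  have S₁ : ContMDiff I (I.tangent.prod I.tangent) 1 F₁ := sfv.prodMk sfg
  let F₂ : (TangentBundle I G × TangentBundle I G) → TangentBundle (I.prod I) (G × G) :=
    (equivTangentBundleProd I G I G).symm
  have S₂ : ContMDiff (I.tangent.prod I.tangent) (I.prod I).tangent 1 F₂ :=
    contMDiff_equivTangentBundleProd_symm
  let F₃ : TangentBundle (I.prod I) (G × G) → TangentBundle I G :=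
    tangentMap (I.prod I) I (fun (p : G × G) ↦ p.1 * p.2)
  have S₃ : ContMDiff (I.prod I).tangent I.tangent 1 F₃ :=
    (contMDiff_mul I ∞).contMDiff_tangentMap (m := 1) (by decide)
  let S := (S₃.comp S₂).comp S₁
  convert! S with g
  · simp [F₁, F₂, F₃, fg, fv]
  · simp only [Function.comp_apply, tangentMap, F₃, F₂, F₁, fg, fv]
    have hmul : MDifferentiable (I.prod I) I (fun p : G × G => p.1 * p.2) :=
      (contMDiff_mul I ∞).mdifferentiable (by simp)
    rw [mfderiv_prod_eq_add_apply (hmul _)]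
    have h1 : ∀ g' : G, g' = 1 * g → (Y g' : E) = mfderiv I I (fun x : G => x * g) 1 (Y 1) := by
      rintro g' rfl
      exact hY 1 g
    have h2 := h1 g (one_mul g).symm
    exact h2.trans ((add_zero _).symm.trans (congrArg₂ (· + ·) rfl (map_zero _).symm))

theorem contMDiff_systemField {m : ℕ} {X : (g : G) → TangentSpace I g}
    {Y : Fin m → (g : G) → TangentSpace I g}
    (hX : ContMDiff I I.tangent 1 (fun g : G => (⟨g, X g⟩ : TangentBundle I G)))
    (hY : ∀ j, IsRightInvariant I (Y j)) (c : Fin m → ℝ) :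
    ContMDiff I I.tangent 1 (fun g : G => (⟨g, systemField I X Y c g⟩ : TangentBundle I G)) :=
  hX.add_section (ContMDiff.sum_section fun j _ =>
    (contMDiff_of_isRightInvariant (hY j)).const_smul_section)

/-- The left-translated term comes from `X` alone and does not involve `c`. This is why a flow line
of `X` is the right factor for every control. -/
theorem systemField_mul {m : ℕ} {X : (g : G) → TangentSpace I g}
    {Y : Fin m → (g : G) → TangentSpace I g} {φ : ℝ → G → G} (hφ : IsFlow I X φ)
    (hmul : ∀ t a b, φ t (a * b) = φ t a * φ t b)
    (hY : ∀ j, IsRightInvariant I (Y j)) (c : Fin m → ℝ) (a b : G) :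
    systemField I X Y c (a * b) = (mfderiv I I (fun x : G => x * b) a (systemField I X Y c a) +
      mfderiv I I (fun x : G => a * x) b (X b) : E) := by
  simp only [systemField]
  rw [hφ.apply_mul hmul, map_add, map_sum]
  simp only [map_smul, fun j => hY j a b]
  exact add_right_comm _ _ _

end LieGroup

/-! ### Solutions of the linear control system -/

section System

variable {E : Type*} [NormedAddCommGroup E] [NormedSpace ℝ E]
  {H : Type*} [TopologicalSpace H] {I : ModelWithCorners ℝ E H}
  {G : Type*} [TopologicalSpace G] [ChartedSpace H G] {m : ℕ}
  {X : (g : G) → TangentSpace I g} {Y : Fin m → (g : G) → TangentSpace I g} {φ : ℝ → G → G}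

theorem IsSolution.solvesOn {u : ℝ → Fin m → ℝ} {g : G} {γ : ℝ → G}
    (h : IsSolution I X Y u g γ) (s : Set ℝ) : SolvesOn I (systemField I X Y) u s γ :=
  fun t _ => h.hasMFDerivAt t

theorem IsSolution.comp_add {u : ℝ → Fin m → ℝ} {g : G} {γ : ℝ → G}
    (h : IsSolution I X Y u g γ) (t : ℝ) :
    IsSolution I X Y (fun r => u (t + r)) (γ t) (fun r => γ (t + r)) where
  continuous := h.continuous.comp (continuous_const.add continuous_id)
  initial := by simp
  hasMFDerivAt r hr := by
    have h1 := h.hasMFDerivAt (t + r) fun hsw => hr (mem_switchTimes_comp_add.2 hsw)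
    have h2 : HasMFDerivAt 𝓘(ℝ, ℝ) 𝓘(ℝ, ℝ) (fun r : ℝ => t + r) r (ContinuousLinearMap.id ℝ ℝ) :=
      ((hasFDerivAt_id r).const_add t).hasMFDerivAt
    exact (h1.comp r h2).congr_mfderiv (ContinuousLinearMap.comp_id _)

variable [Group G] [LieGroup I ∞ G]

/-- The product of a solution with control `u` and a flow line of the linear field is again a
solution with control `u`. -/
theorem solvesOn_mul_flow (hφ : IsFlow I X φ) (hmul : ∀ t a b, φ t (a * b) = φ t a * φ t b)
    (hY : ∀ j, IsRightInvariant I (Y j)) {u : ℝ → Fin m → ℝ} {s : Set ℝ} {γ : ℝ → G}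
    (h : SolvesOn I (systemField I X Y) u s γ) (g : G) :
    SolvesOn I (systemField I X Y) u s (fun t => γ t * φ t g) := by
  intro t ht hsw
  refine (hasMFDerivAt_mul_curve (h t ht hsw) ((hφ g).2 t)).congr_mfderiv ?_
  rw [systemField_mul hφ hmul hY]

variable [BoundarylessManifold I G] [T2Space G]

/-- By uniqueness of integral curves, any flow of `X` is the flow by automorphisms that linearity
provides. -/
theorem IsLinearVectorField.flow_mul (hX : IsLinearVectorField I X) (hφ : IsFlow I X φ) (t : ℝ)
    (a b : G) : φ t (a * b) = φ t a * φ t b := by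
  obtain ⟨hsm, ψ, hψ, hψaut⟩ := hX
  have heq (g : G) : (fun t => φ t g) = fun t => ψ t g :=
    isMIntegralCurve_Ioo_eq_of_contMDiff_boundaryless (t₀ := 0) (hsm.of_le (by simp)) (hφ g).2
      (hψ g).2 ((hφ g).1.trans (hψ g).1.symm)
  obtain ⟨e, he, -⟩ := hψaut t
  rw [congrFun (heq (a * b)) t, congrFun (heq a) t, congrFun (heq b) t, ← he, ← he, ← he, map_mul]

theorem isCompleteFamily_systemField [CompleteSpace E] (hX : IsLinearVectorField I X)
    (hY : ∀ j, IsRightInvariant I (Y j)) (hφ : IsFlow I X φ) :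
    IsCompleteFamily I (systemField I X Y) := by
  have hsm (c : Fin m → ℝ) := contMDiff_systemField (hX.1.of_le (by simp)) hY c
  refine ⟨hsm, fun c x t₀ => ?_⟩
  obtain ⟨γ, hγ₀, hγ⟩ := exists_isMIntegralCurveAt_of_contMDiffAt_boundaryless 0
    (hsm c).contMDiffAt (x₀ := (1 : G))
  obtain ⟨ε, hε, hball⟩ := isMIntegralCurveAt_iff'.1 hγ
  rw [Real.ball_eq_Ioo, zero_sub, zero_add] at hball
  -- An existence time independent of the starting point makes a `C^1` field complete.
  have hunif (g : G) : ∃ χ : ℝ → G, χ 0 = g ∧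
      IsMIntegralCurveOn χ (systemField I X Y c) (Ioo (-ε) ε) := by
    refine ⟨fun t => γ t * φ t g, by simp [hγ₀, (hφ g).1], ?_⟩
    have h1 : SolvesOn I (systemField I X Y) (fun _ => c) (Ioo (-ε) ε) γ := fun t ht _ =>
      (hball t ht).hasMFDerivAt (Ioo_mem_nhds ht.1 ht.2)
    intro t ht
    exact (solvesOn_mul_flow hφ (hX.flow_mul hφ) hY h1 g t ht
      (by simp [switchTimes_const])).hasMFDerivWithinAt
  obtain ⟨χ, hχ₀, hχ⟩ := exists_isMIntegralCurve_of_isMIntegralCurveOn (hsm c) hε hunif x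
  exact ⟨χ ∘ (· + -t₀), by simp [hχ₀], hχ.comp_add _⟩

theorem IsSolution.eq (hF : IsCompleteFamily I (systemField I X Y)) {u : ℝ → Fin m → ℝ}
    (hu : IsPiecewiseConstant u) {g : G} {γ₁ γ₂ : ℝ → G} (h₁ : IsSolution I X Y u g γ₁)
    (h₂ : IsSolution I X Y u g γ₂) : γ₁ = γ₂ := by
  ext t
  exact eqOn_Icc_of_solvesOn hF hu h₁.continuous h₂.continuous (a := -|t|) (b := |t|) (t₀ := 0)
    (by simp) (h₁.initial.trans h₂.initial.symm) (h₁.solvesOn _) (h₂.solvesOn _)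
    ⟨neg_abs_le t, le_abs_self t⟩

theorem isSolution_solution (hF : IsCompleteFamily I (systemField I X Y)) {u : ℝ → Fin m → ℝ}
    (hu : IsPiecewiseConstant u) (g : G) :
    IsSolution I X Y u g (fun t => solution I X Y t u g) := by
  obtain ⟨γ, hγ, h₀, e⟩ := exists_solvesOn_univ hF hu g
  have hex : ∃ γ : ℝ → G, IsSolution I X Y u g γ := ⟨γ, hγ, h₀, fun t => e t (mem_univ t)⟩
  simpa only [solution, dif_pos hex] using hex.choose_spec

/-- A solution depends, between time `0` and time `s`, only on the control between these times. -/
theorem solution_eq_of_eq_const (hF : IsCompleteFamily I (systemField I X Y))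
    {u : ℝ → Fin m → ℝ} (hu : IsPiecewiseConstant u) {c : Fin m → ℝ} {s : ℝ}
    (h : ∀ r ∈ uIoo 0 s, u r = c) (g : G) :
    solution I X Y s u g = solution I X Y s (fun _ => c) g := by
  have hc := isPiecewiseConstant_const c
  have h₁ := isSolution_solution hF hu g
  have h₂ := isSolution_solution hF hc g
  -- On the open interval the equations for `u` and for `c` coincide; the values of `u` at the
  -- endpoints play no role.
  have e₁ : SolvesOn I (systemField I X Y) (fun _ => c) (uIoo 0 s)
      (fun t => solution I X Y t u g) := by
    intro t ht _
    have := h₁.hasMFDerivAt t (notMem_switchTimes_of_isOpen isOpen_Ioo h ht)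
    rwa [h t ht] at this
  exact eqOn_Icc_of_solvesOn hF hc h₁.continuous h₂.continuous (a := min 0 s) (b := max 0 s)
    (t₀ := 0) ⟨min_le_left _ _, le_max_left _ _⟩ (h₁.initial.trans h₂.initial.symm) e₁
    (h₂.solvesOn _) ⟨min_le_right _ _, le_max_right _ _⟩

theorem solution_eq_mul_flow (hF : IsCompleteFamily I (systemField I X Y)) (hφ : IsFlow I X φ)
    (hmul : ∀ t a b, φ t (a * b) = φ t a * φ t b) (hY : ∀ j, IsRightInvariant I (Y j))
    {u : ℝ → Fin m → ℝ} (hu : IsPiecewiseConstant u) (g : G) (t : ℝ) :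
    solution I X Y t u g = solution I X Y t u 1 * φ t g := by
  have h₁ := isSolution_solution hF hu (1 : G)
  have : ContinuousMul G := continuousMul_of_contMDiffMul I ∞
  have h : IsSolution I X Y u g (fun t => solution I X Y t u 1 * φ t g) :=
    { continuous := h₁.continuous.mul (hφ g).2.continuous
      initial := by simp [h₁.initial, (hφ g).1]
      hasMFDerivAt := fun t => solvesOn_mul_flow hφ hmul hY (h₁.solvesOn univ) g t (mem_univ t) }
  exact congrFun ((isSolution_solution hF hu g).eq hF hu h) t

theorem solution_add (hF : IsCompleteFamily I (systemField I X Y))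
    {u : ℝ → Fin m → ℝ} (hu : IsPiecewiseConstant u) (g : G) (t s : ℝ) :
    solution I X Y (t + s) u g =
      solution I X Y s (fun r => u (t + r)) (solution I X Y t u g) :=
  congrFun (((isSolution_solution hF hu g).comp_add t).eq hF (hu.comp_add t)
    (isSolution_solution hF (hu.comp_add t) _)) s

theorem solution_add_of_eq_const (hF : IsCompleteFamily I (systemField I X Y)) (hφ : IsFlow I X φ)
    (hmul : ∀ t a b, φ t (a * b) = φ t a * φ t b) (hY : ∀ j, IsRightInvariant I (Y j))
    {u : ℝ → Fin m → ℝ} (hu : IsPiecewiseConstant u) {c : Fin m → ℝ} (g : G) {t s : ℝ}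
    (h : ∀ r ∈ uIoo t (t + s), u r = c) :
    solution I X Y (t + s) u g =
      solution I X Y s (fun _ => c) 1 * φ s (solution I X Y t u g) := by
  rw [solution_add hF hu, solution_eq_of_eq_const hF (hu.comp_add t) (c := c) ?_,
    solution_eq_mul_flow hF hφ hmul hY (isPiecewiseConstant_const c)]
  rintro r ⟨h1, h2⟩
  refine h _ ⟨?_, ?_⟩
  · rcases le_total 0 s with hs | hs <;> simp [hs] at h1 ⊢ <;> linarith
  · rcases le_total 0 s with hs | hs <;> simp [hs] at h2 ⊢ <;> linarith

end System

end LinearControl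

theorem corollary3p5
    {E : Type*} [NormedAddCommGroup E] [NormedSpace ℝ E] [FiniteDimensional ℝ E]
    {H : Type*} [TopologicalSpace H] (I : ModelWithCorners ℝ E H)
    {G : Type*} [TopologicalSpace G] [ChartedSpace H G] [Group G] [LieGroup I ∞ G]
    [BoundarylessManifold I G] [T2Space G] [ConnectedSpace G]
    {m : ℕ} (X : (g : G) → TangentSpace I g) (Y : Fin m → (g : G) → TangentSpace I g)
    (hX : LinearControl.IsLinearVectorField I X)
    (hY : ∀ j, LinearControl.IsRightInvariant I (Y j))
    (φ : ℝ → G → G) (hφ : LinearControl.IsFlow I X φ) :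
    -- for each control and each starting point there is exactly one solution, namely `φ_t(u, g)`
    (∀ u : ℝ → Fin m → ℝ, LinearControl.IsPiecewiseConstant u → ∀ g : G,
      LinearControl.IsSolution I X Y u g (fun t => LinearControl.solution I X Y t u g) ∧
      ∀ γ : ℝ → G, LinearControl.IsSolution I X Y u g γ →
        ∀ t : ℝ, γ t = LinearControl.solution I X Y t u g) ∧
    -- the factorization `φ_t(u, g) = φ_t(u, e) φ_t(g)`
    (∀ u : ℝ → Fin m → ℝ, LinearControl.IsPiecewiseConstant u → ∀ (g : G) (t : ℝ),
      LinearControl.solution I X Y t u g = LinearControl.solution I X Y t u 1 * φ t g) ∧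
    -- the cocycle property
    (∀ u : ℝ → Fin m → ℝ, LinearControl.IsPiecewiseConstant u → ∀ (g : G) (t s : ℝ),
      LinearControl.solution I X Y (t + s) u g =
        LinearControl.solution I X Y s (fun r => u (t + r)) (LinearControl.solution I X Y t u g)) ∧
    -- crossing one interval on which the control has the constant value `c`
    (∀ u : ℝ → Fin m → ℝ, LinearControl.IsPiecewiseConstant u →
      ∀ (c : Fin m → ℝ) (g : G) (t s : ℝ), (∀ r ∈ Set.uIoo t (t + s), u r = c) →
        LinearControl.solution I X Y (t + s) u g =
          LinearControl.solution I X Y s (fun _ => c) 1 *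
            φ s (LinearControl.solution I X Y t u g)) ∧
    -- a control with the value `c₁` on `[0, t]` and `c₂` on `(t, t + s]`
    (∀ u : ℝ → Fin m → ℝ, LinearControl.IsPiecewiseConstant u →
      ∀ (c₁ c₂ : Fin m → ℝ) (t s : ℝ), 0 ≤ t → 0 ≤ s →
        (∀ r ∈ Set.Icc 0 t, u r = c₁) → (∀ r ∈ Set.Ioc t (t + s), u r = c₂) →
          LinearControl.solution I X Y (t + s) u 1 =
            LinearControl.solution I X Y s (fun _ => c₂) 1 *
              φ s (LinearControl.solution I X Y t (fun _ => c₁) 1)) := by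
  have : CompleteSpace E := FiniteDimensional.complete ℝ E
  have hmul := hX.flow_mul hφ
  have hF := LinearControl.isCompleteFamily_systemField hX hY hφ
  refine ⟨fun u hu g => ⟨LinearControl.isSolution_solution hF hu g, fun γ hγ t =>
      congrFun (hγ.eq hF hu (LinearControl.isSolution_solution hF hu g)) t⟩,
    fun u hu g t => LinearControl.solution_eq_mul_flow hF hφ hmul hY hu g t,
    fun u hu g t s => LinearControl.solution_add hF hu g t s,
    fun u hu c g t s h => LinearControl.solution_add_of_eq_const hF hφ hmul hY hu g h,
    fun u hu c₁ c₂ t s ht hs h₁ h₂ => ?_⟩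
  rw [LinearControl.solution_add_of_eq_const hF hφ hmul hY hu (c := c₂) 1 ?_,
    LinearControl.solution_eq_of_eq_const hF hu (c := c₁) ?_]
  · rw [Set.uIoo_of_le ht]
    exact fun r hr => h₁ r ⟨hr.1.le, hr.2.le⟩
  · rw [Set.uIoo_of_le (by linarith)]
    exact fun r hr => h₂ r ⟨hr.1, hr.2.le⟩
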